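/- Let $\gamma>0$ and let $(X,d,\mu)$ be an Ahlfors $\gamma$-regular space: $(X,d)$ is a metric space and $\mu$ is a Borel measure with $c_1r^\gamma\le\mu(B(x,r))\le c_2r^\gamma$ for some constants $c_1,c_2>0$, every $x\in X$ and every $r>0$, where $B(x,r)$ is the open ball. Let $\mathcal D=\bigcup_{j\in\mathbb Z}\mathcal D_j$ be a dyadic family on $X$, that is: for some $0<\nu<1$, every $Q\in\mathcal D_j$ has $\operatorname{diam}Q\simeq\nu^j$ and eccentricity $\simeq 1$, with constants independent of $j$ and $Q$ (the eccentricity of $Q$ is the supremum of $r_1/r_2$ over the balls $B(x_1,r_1)\subseteq Q\subseteq B(x_2,r_2)$); every $Q\in\mathcal D$ is a Borel set; each $\mathcal D_j$ is a partition of $X$; each $Q\in\mathcal D_{j+1}$ is contained in exactly one cube of $\mathcal D_j$; for some constant $M$, every $Q\in\mathcal D_j$ contains at least one and at most $M$ cubes of $\mathcal D_{j+1}$; two cubes of $\mathcal D$ are disjoint or one contains the other; and for every $Q\in\mathcal D$ the union of the cubes of $\mathcal D$ that contain $Q$ is $X$. Let $\delta(x,x)=0$ and $\delta(x,y)=\inf\{\mu(Q):Q\in\mathcal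 D,\ x,y\in Q\}$ for $x\ne y$. For $\sigma>0$ and $u\in L^2(X,\mu)$ (real valued) put $$\mathscr E^{d,\mu}_\sigma(u)=\iint_{X\times X}\frac{|u(x)-u(y)|^2}{\mu(B(x,d(x,y)))^{1+2\sigma}}\,d\mu(x)\,d\mu(y),\qquad \mathscr E^{\delta,\mu}_\sigma(u)=\iint_{X\times X}\frac{|u(x)-u(y)|^2}{\delta(x,y)^{1+2\sigma}}\,d\mu(x)\,d\mu(y),$$ both with values in $[0,\infty]$, and let $H^\sigma_{d,\mu}$ and $H^\sigma_{\delta,\mu}$ be the spaces of those $u\in L^2(X,\mu)$ for which the first, respectively the second, energy is finite, with the norms $\|u\|_{L^2}+\sqrt{\mathscr E^{d,\mu}_\sigma(u)}$ and $\|u\|_{L^2}+\sqrt{\mathscr E^{\delta,\mu}_\sigma(u)}$. Let $P_j$ be the orthogonal projector of $L^2(X,\mu)$ onto $V_j=\{f\in L^2(X,\mu): f|_Q\text{ is constant for every }Q\in\mathcal D_j\}$. A Hilbert subspace of one of these two spaces is a linear subspace that is complete for its norm; a Hilbert subspace $S$ of $H^\sigma_{d,\mu}$ is a space of coercivity for $\mathscr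 E^{d,\mu}_\sigma$ if there is $c>0$ with $\mathscr E^{d,\mu}_\sigma(u)\ge c\|u\|^2_{L^2}$ for all $u\in S$. Then, for every $\sigma>0$ and every $j\in\mathbb Z$: 1. $H^\sigma_{d,\mu}\subseteq H^\sigma_{\delta,\mu}$, and $H^\sigma_{\delta,\mu}\cap\operatorname{Ker}P_j$ is a Hilbert subspace of $H^\sigma_{\delta,\mu}$. 2. There is a constant $C>0$, depending on $j$ (and on $X,d,\mu,\mathcal D,\sigma$) but not on $u$, such that $\mathscr E^{d,\mu}_\sigma(u)\ge C\|u\|^2_{L^2}$ for every $u\in H^\sigma_{\delta,\mu}\cap\operatorname{Ker}P_j$ (where $\mathscr E^{d,\mu}_\sigma(u)$ may be $+\infty$). 3. $H^\sigma_{d,\mu}\cap\operatorname{Ker}P_j$ is a space of coercivity for $\mathscr E^{d,\mu}_\sigma$. -/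

import Mathlib

open MeasureTheory Filter Topology
open scoped ENNReal

noncomputable section

namespace DyadicCoercivity

variable {X : Type*}

/-- The measure `μ` is Ahlfors `γ`-regular: `c₁ r ^ γ ≤ μ (B(x, r)) ≤ c₂ r ^ γ` for all `x` and
all `r > 0`, with positive constants `c₁`, `c₂`. -/
def IsAhlforsRegular [MetricSpace X] [MeasurableSpace X] (μ : Measure X) (γ : ℝ) : Prop :=
  ∃ c₁ c₂ : ℝ, 0 < c₁ ∧ 0 < c₂ ∧ ∀ (x : X) (r : ℝ), 0 < r →
    ENNReal.ofReal (c₁ * r ^ γ) ≤ μ (Metric.ball x r) ∧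
      μ (Metric.ball x r) ≤ ENNReal.ofReal (c₂ * r ^ γ)

/-- The eccentricity of `Q`: the supremum of the quotients `r₁ / r₂` of the radii of balls
`B(x₁, r₁) ⊆ Q` and `B(x₂, r₂) ⊇ Q`. -/
def eccentricity [MetricSpace X] (Q : Set X) : ℝ≥0∞ :=
  sSup {t | ∃ (x₁ x₂ : X) (r₁ r₂ : ℝ), 0 < r₁ ∧ 0 < r₂ ∧
    Metric.ball x₁ r₁ ⊆ Q ∧ Q ⊆ Metric.ball x₂ r₂ ∧ t = ENNReal.ofReal (r₁ / r₂)}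

/-- `D j` is the family of the dyadic cubes of level `j`; smaller cubes have larger levels. -/
structure IsDyadicFamily [MetricSpace X] [MeasurableSpace X] (D : ℤ → Set (Set X)) : Prop where
  /-- Cubes of level `j` have diameter comparable to `ν ^ j`. -/
  diam : ∃ ν a b : ℝ, 0 < ν ∧ ν < 1 ∧ 0 < a ∧ 0 < b ∧ ∀ (j : ℤ), ∀ Q ∈ D j,
    ENNReal.ofReal (a * ν ^ j) ≤ Metric.ediam Q ∧ Metric.ediam Q ≤ ENNReal.ofReal (b * ν ^ j)
  /-- The eccentricity of all cubes is comparable to `1`. -/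
  ecc : ∃ a b : ℝ, 0 < a ∧ 0 < b ∧ ∀ (j : ℤ), ∀ Q ∈ D j,
    ENNReal.ofReal a ≤ eccentricity Q ∧ eccentricity Q ≤ ENNReal.ofReal b
  /-- Cubes are Borel sets. -/
  measurable : ∀ (j : ℤ), ∀ Q ∈ D j, MeasurableSet Q
  /-- The cubes of each level form a partition of the space. -/
  partition : ∀ j : ℤ, Setoid.IsPartition (D j)
  /-- Each cube has exactly one father. -/
  father : ∀ (j : ℤ), ∀ Q ∈ D (j + 1), ∃! Q' : Set X, Q' ∈ D j ∧ Q ⊆ Q'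
  /-- The number of children of a cube is at least `1` and is bounded. -/
  offspring : ∃ M : ℕ, ∀ (j : ℤ), ∀ Q ∈ D j,
    1 ≤ {Q' | Q' ∈ D (j + 1) ∧ Q' ⊆ Q}.encard ∧ {Q' | Q' ∈ D (j + 1) ∧ Q' ⊆ Q}.encard ≤ M
  /-- Two cubes are disjoint or nested. -/
  nested : ∀ (i j : ℤ), ∀ Q ∈ D i, ∀ Q' ∈ D j, Disjoint Q' Q ∨ Q' ⊆ Q ∨ Q ⊆ Q'
  /-- The whole space is a quadrant. -/
  quadrant : ∀ (j : ℤ), ∀ Q ∈ D j, ⋃₀ {Q' | (∃ i : ℤ, Q' ∈ D i) ∧ Q ⊆ Q'} = Set.univ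

/-- The dyadic distance `δ`: zero on the diagonal, and otherwise the infimum of the measures of
the cubes that contain both points. -/
def dyadicDist [MeasurableSpace X] (μ : Measure X) (D : ℤ → Set (Set X)) (x y : X) : ℝ≥0∞ :=
  open Classical in
  if x = y then 0 else sInf {t | ∃ (j : ℤ) (Q : Set X), Q ∈ D j ∧ x ∈ Q ∧ y ∈ Q ∧ t = μ Q}

/-- The energy `∬ |u(x) - u(y)|² / K(x, y) ^ (1 + 2σ) dμ(y) dμ(x)` with values in `[0, ∞]`. -/
def energy [MeasurableSpace X] (μ : Measure X) (K : X → X → ℝ≥0∞) (σ : ℝ) (u : X → ℝ) : ℝ≥0∞ :=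
  ∫⁻ x, ∫⁻ y, ‖u x - u y‖ₑ ^ 2 / (K x y) ^ (1 + 2 * σ) ∂μ ∂μ

/-- The energy of the metric measure space: the kernel is `μ (B(x, d(x, y)))`. -/
def metricEnergy [MetricSpace X] [MeasurableSpace X] (μ : Measure X) (σ : ℝ)
    (u : Lp ℝ 2 μ) : ℝ≥0∞ :=
  energy μ (fun x y => μ (Metric.ball x (dist x y))) σ u

/-- The dyadic energy: the kernel is the dyadic distance. -/
def dyadicEnergy [MeasurableSpace X] (μ : Measure X) (D : ℤ → Set (Set X)) (σ : ℝ)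
    (u : Lp ℝ 2 μ) : ℝ≥0∞ :=
  energy μ (dyadicDist μ D) σ u

/-- The space of the functions in `L²` of finite energy `E`. -/
def finiteEnergy [MeasurableSpace X] {μ : Measure X} (E : Lp ℝ 2 μ → ℝ≥0∞) : Set (Lp ℝ 2 μ) :=
  {u | E u < ∞}

/-- The norm `‖u‖_{L²} + √E(u)`. -/
def energyNorm [MeasurableSpace X] {μ : Measure X} (E : Lp ℝ 2 μ → ℝ≥0∞) (u : Lp ℝ 2 μ) : ℝ≥0∞ :=
  ‖u‖ₑ + E u ^ (1 / 2 : ℝ)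

/-- `S` is a Hilbert subspace of the space of finite energy: a linear subspace which is complete
for the norm `‖u‖_{L²} + √E(u)`. -/
structure IsHilbertSubspace [MeasurableSpace X] {μ : Measure X} (E : Lp ℝ 2 μ → ℝ≥0∞)
    (S : Set (Lp ℝ 2 μ)) : Prop where
  subset : S ⊆ finiteEnergy E
  linear : ∃ V : Submodule ℝ (Lp ℝ 2 μ), (V : Set (Lp ℝ 2 μ)) = S
  complete : ∀ f : ℕ → Lp ℝ 2 μ, (∀ n, f n ∈ S) →
    (∀ ε : ℝ≥0∞, 0 < ε → ∃ N, ∀ m ≥ N, ∀ n ≥ N, energyNorm E (f m - f n) < ε) →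
    ∃ u ∈ S, Tendsto (fun n => energyNorm E (f n - u)) atTop (𝓝 0)

/-- The inequality `E(u) ≥ c ‖u‖²_{L²}` on `S`, with a constant `c > 0`. -/
def IsCoerciveOn [MeasurableSpace X] {μ : Measure X} (E : Lp ℝ 2 μ → ℝ≥0∞)
    (S : Set (Lp ℝ 2 μ)) : Prop :=
  ∃ c : ℝ, 0 < c ∧ ∀ u ∈ S, ENNReal.ofReal (c * ‖u‖ ^ 2) ≤ E u

/-- A space of coercivity for `E`. -/
def IsCoercivitySpace [MeasurableSpace X] {μ : Measure X} (E : Lp ℝ 2 μ → ℝ≥0∞)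
    (S : Set (Lp ℝ 2 μ)) : Prop :=
  IsHilbertSubspace E S ∧ IsCoerciveOn E S

/-- The space `V_j` of the functions in `L²` that are constant on every cube of level `j`. -/
def levelSpace [MeasurableSpace X] (μ : Measure X) (D : ℤ → Set (Set X)) (j : ℤ) :
    Submodule ℝ (Lp ℝ 2 μ) where
  carrier := {f | ∀ Q ∈ D j, ∃ c : ℝ, ∀ᵐ x ∂(μ.restrict Q), f x = c}
  zero_mem' := fun Q _ => ⟨0, ae_restrict_of_ae (Lp.coeFn_zero ℝ 2 μ)⟩
  add_mem' := by
    intro f g hf hg Q hQ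
    obtain ⟨a, ha⟩ := hf Q hQ
    obtain ⟨b, hb⟩ := hg Q hQ
    refine ⟨a + b, ?_⟩
    filter_upwards [ha, hb, ae_restrict_of_ae (Lp.coeFn_add f g)] with x h1 h2 h3
    rw [h3, Pi.add_apply, h1, h2]
  smul_mem' := by
    intro r f hf Q hQ
    obtain ⟨a, ha⟩ := hf Q hQ
    refine ⟨r * a, ?_⟩
    filter_upwards [ha, ae_restrict_of_ae (Lp.coeFn_smul r f)] with x h1 h2
    rw [h2, Pi.smul_apply, h1, smul_eq_mul]

theorem isClosed_levelSpace [MeasurableSpace X] (μ : Measure X) (D : ℤ → Set (Set X)) (j : ℤ) :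
    IsClosed (levelSpace μ D j : Set (Lp ℝ 2 μ)) := by
  refine IsSeqClosed.isClosed ?_
  intro f g hf hfg Q hQ
  obtain ⟨ns, -, hns⟩ := (tendstoInMeasure_of_tendsto_Lp hfg).exists_seq_tendsto_ae
  have hc : ∀ k, ∃ c : ℝ, ∀ᵐ x ∂(μ.restrict Q), f (ns k) x = c := fun k => hf (ns k) Q hQ
  choose c hc using hc
  have h1 : ∀ᵐ x ∂(μ.restrict Q), Tendsto c atTop (𝓝 (g x)) := by
    filter_upwards [ae_restrict_of_ae hns, ae_all_iff.2 hc] with x hx h2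
    simpa only [h2] using hx
  by_cases h0 : ae (μ.restrict Q) = ⊥
  · exact ⟨0, by simp [Filter.Eventually, h0]⟩
  · have : (ae (μ.restrict Q)).NeBot := ⟨h0⟩
    obtain ⟨x₀, hx₀⟩ := h1.exists
    refine ⟨g x₀, ?_⟩
    filter_upwards [h1] with x hx
    exact tendsto_nhds_unique hx hx₀

instance [MeasurableSpace X] (μ : Measure X) (D : ℤ → Set (Set X)) (j : ℤ) :
    CompleteSpace (levelSpace μ D j) :=
  (isClosed_levelSpace μ D j).completeSpace_coe

/-- The orthogonal projector `P_j` of `L²` onto `V_j`. -/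
def levelProj [MeasurableSpace X] (μ : Measure X) (D : ℤ → Set (Set X)) (j : ℤ) :
    Lp ℝ 2 μ →L[ℝ] Lp ℝ 2 μ :=
  (levelSpace μ D j).starProjection

/-- The kernel of `P_j`. -/
def levelKer [MeasurableSpace X] (μ : Measure X) (D : ℤ → Set (Set X)) (j : ℤ) :
    Set (Lp ℝ 2 μ) :=
  {u | levelProj μ D j u = 0}

end DyadicCoercivity

end

/-! Inclusion: if `x ≠ y` lie in a cube `Q`, the eccentricity bound puts `Q` between two balls of
comparable radii, so regularity gives `μ(B(x, d(x,y))) ≤ C μ(Q)`. The infimum over `Q` gives `μ(B(x,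
d(x,y))) ≤ C δ(x,y)` (`exists_measure_ball_le_dyadicDist`), and the energies compare with factor `C
^ (1 + 2σ)`.

Coercivity: `u ∈ Ker P_j` is orthogonal to the indicator of each level-`j` cube `Q`, so it has mean
zero there and `∫_Q |u(x) - u(y)|² dμ(y) ≥ μ(Q) |u(x)|²`. At level `j` the measures `μ(Q)` are at
least some `m > 0` and the metric kernel is at most some `C` on `Q × Q`. Keeping only the `y` in the
cube of `x` yields the constant `m / C ^ (1 + 2σ)` (`le_energy_of_mem_levelKer`).

Completeness: Fatou's lemma makes the energy lower semicontinuous, so an `L²` limit of a Cauchy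
sequence is also its limit in the energy norm; `Ker P_j` is closed in `L²`
(`isHilbertSubspace_inter`). -/

open Set

namespace DyadicCoercivity

/-! ### Energies with a general measurable kernel; completeness. -/

section Energy

variable {X : Type*} [MeasurableSpace X] {μ : Measure X} {K : X → X → ℝ≥0∞} {σ : ℝ}

theorem energy_congr_ae {u v : X → ℝ} (h : u =ᵐ[μ] v) :
    energy μ K σ u = energy μ K σ v := by
  refine lintegral_congr_ae ?_
  filter_upwards [h] with x hx
  refine lintegral_congr_ae ?_
  filter_upwards [h] with y hy
  rw [hx, hy]

/-- On the diagonal the numerator vanishes, and `0 / 0 = 0` in `ℝ≥0∞`. This lets `δ` be replaced by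
`cubeKernel`. -/
theorem energy_congr_kernel {K' : X → X → ℝ≥0∞} (h : ∀ x y, x ≠ y → K x y = K' x y)
    (u : X → ℝ) : energy μ K σ u = energy μ K' σ u := by
  refine lintegral_congr fun x => lintegral_congr fun y => ?_
  rcases eq_or_ne x y with rfl | hxy
  · simp
  · rw [h x y hxy]

/-- The integrand of the energy is jointly measurable. -/
theorem measurable_energy_integrand (hK : Measurable (Function.uncurry K)) {u : X → ℝ}
    (hu : Measurable u) :
    Measurable fun p : X × X => ‖u p.1 - u p.2‖ₑ ^ 2 / (K p.1 p.2) ^ (1 + 2 * σ) := by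
  have hK' : Measurable fun p : X × X => K p.1 p.2 := hK
  fun_prop

theorem enorm_sq_eq_ofReal (t : ℝ) : ‖t‖ₑ ^ 2 = ENNReal.ofReal (t ^ 2) := by
  rw [← sq_abs, ENNReal.ofReal_pow (abs_nonneg t), ← Real.norm_eq_abs, ofReal_norm]

theorem enorm_add_sq_le (a b : ℝ) : ‖a + b‖ₑ ^ 2 ≤ 2 * ‖a‖ₑ ^ 2 + 2 * ‖b‖ₑ ^ 2 := by
  have h2 : (2 : ℝ≥0∞) = ENNReal.ofReal 2 := by simp
  simp only [enorm_sq_eq_ofReal]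
  rw [h2, ← ENNReal.ofReal_mul zero_le_two, ← ENNReal.ofReal_mul zero_le_two,
    ← ENNReal.ofReal_add (by positivity) (by positivity)]
  exact ENNReal.ofReal_le_ofReal (by nlinarith [sq_nonneg (a - b)])

/-- This crude substitute for the triangle inequality is enough to show that finite energy is
preserved by sums. -/
theorem energy_add_le [SFinite μ] (hK : Measurable (Function.uncurry K)) {u v : X → ℝ}
    (hu : Measurable u) (hv : Measurable v) :
    energy μ K σ (fun x => u x + v x) ≤ 2 * energy μ K σ u + 2 * energy μ K σ v := by
  have hmu := measurable_energy_integrand (σ := σ) hK hu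
  have hmv := measurable_energy_integrand (σ := σ) hK hv
  unfold energy
  rw [← lintegral_const_mul _ hmu.lintegral_prod_right',
    ← lintegral_const_mul _ hmv.lintegral_prod_right',
    ← lintegral_add_left (hmu.lintegral_prod_right'.const_mul 2)]
  refine lintegral_mono fun x => ?_
  have hux := hmu.comp (measurable_prodMk_left (x := x))
  have hvx := hmv.comp (measurable_prodMk_left (x := x))
  dsimp only [Function.comp_def] at hux hvx
  dsimp only
  rw [← lintegral_const_mul _ hux, ← lintegral_const_mul _ hvx,
    ← lintegral_add_left (hux.const_mul 2)]
  refine lintegral_mono fun y => ?_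
  dsimp only
  rw [← mul_div_assoc, ← mul_div_assoc, ← ENNReal.add_div]
  refine ENNReal.div_le_div_right ?_ _
  rw [add_sub_add_comm]
  exact enorm_add_sq_le _ _

theorem energy_const_mul (c : ℝ) (u : X → ℝ) :
    energy μ K σ (fun x => c * u x) = ‖c‖ₑ ^ 2 * energy μ K σ u := by
  unfold energy
  rw [← lintegral_const_mul' _ _ (by simp)]
  refine lintegral_congr fun x => ?_
  rw [← lintegral_const_mul' _ _ (by simp)]
  refine lintegral_congr fun y => ?_
  rw [← mul_sub, enorm_mul, mul_pow, mul_div_assoc]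

/-- Lower semicontinuity of the energy under convergence almost everywhere. -/
theorem energy_le_liminf [SFinite μ] (hK : Measurable (Function.uncurry K)) {f : ℕ → X → ℝ}
    {u : X → ℝ} (hf : ∀ n, Measurable (f n))
    (h : ∀ᵐ x ∂μ, Tendsto (fun n => f n x) atTop (𝓝 (u x))) :
    energy μ K σ u ≤ liminf (fun n => energy μ K σ (f n)) atTop := by
  have hm := fun n => measurable_energy_integrand (σ := σ) hK (hf n)
  have hmo : ∀ n, Measurable fun x =>
      ∫⁻ y, ‖f n x - f n y‖ₑ ^ 2 / (K x y) ^ (1 + 2 * σ) ∂μ :=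
    fun n => (hm n).lintegral_prod_right'
  unfold energy
  refine le_trans ?_ (lintegral_liminf_le hmo)
  refine lintegral_mono_ae ?_
  filter_upwards [h] with x hx
  have hmx : ∀ n, Measurable fun y => ‖f n x - f n y‖ₑ ^ 2 / (K x y) ^ (1 + 2 * σ) :=
    fun n => by simpa only [Function.comp_def] using (hm n).comp (measurable_prodMk_left (x := x))
  refine le_trans ?_ (lintegral_liminf_le hmx)
  refine lintegral_mono_ae ?_
  filter_upwards [h] with y hy
  -- The kernel may vanish, and division by `0` is not continuous at numerator `0`; there the limit
  -- integrand is `0` and the bound is trivial.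
  rcases eq_or_ne (‖u x - u y‖ₑ ^ 2) 0 with h0 | h0
  · simp [h0]
  · have hlim : Tendsto (fun n => ‖f n x - f n y‖ₑ ^ 2) atTop (𝓝 (‖u x - u y‖ₑ ^ 2)) :=
      ENNReal.Tendsto.pow (hx.sub hy).enorm
    exact (ENNReal.Tendsto.div_const hlim (Or.inl h0)).liminf_eq.ge

/-- The functions of finite energy in a closed subspace of `L²` form a Hilbert subspace. -/
theorem isHilbertSubspace_inter [SFinite μ] (hK : Measurable (Function.uncurry K))
    (E : Lp ℝ 2 μ → ℝ≥0∞) (hE : ∀ u, E u = energy μ K σ u) (N : Submodule ℝ (Lp ℝ 2 μ))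
    (hN : IsClosed (N : Set (Lp ℝ 2 μ))) :
    IsHilbertSubspace E (finiteEnergy E ∩ N) := by
  have hmeas : ∀ u : Lp ℝ 2 μ, Measurable u := fun u => (Lp.stronglyMeasurable u).measurable
  have hadd : ∀ u v, E (u + v) ≤ 2 * E u + 2 * E v := fun u v => by
    rw [hE, hE, hE, energy_congr_ae (Lp.coeFn_add u v)]
    exact energy_add_le hK (hmeas u) (hmeas v)
  have hsmul : ∀ (c : ℝ) u, E (c • u) = ‖c‖ₑ ^ 2 * E u := fun c u => by
    rw [hE, hE, energy_congr_ae (Lp.coeFn_smul c u)]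
    exact energy_const_mul c u
  have haddfin : ∀ {u v}, E u < ∞ → E v < ∞ → E (u + v) < ∞ := fun {u v} hu hv =>
    (hadd u v).trans_lt (ENNReal.add_lt_top.2
      ⟨ENNReal.mul_lt_top (by simp) hu, ENNReal.mul_lt_top (by simp) hv⟩)
  refine ⟨inter_subset_left, ⟨{
    carrier := finiteEnergy E ∩ N
    add_mem' := ?_
    zero_mem' := ?_
    smul_mem' := ?_ }, rfl⟩, ?_⟩
  · exact fun hu hv => ⟨haddfin hu.1 hv.1, N.add_mem hu.2 hv.2⟩
  · refine ⟨?_, N.zero_mem⟩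
    have := hsmul 0 0
    simp only [zero_smul, enorm_zero, ne_eq, OfNat.ofNat_ne_zero, not_false_eq_true, zero_pow,
      zero_mul] at this
    simp [finiteEnergy, this]
  · refine fun c u hu => ⟨?_, N.smul_mem c hu.2⟩
    change E (c • u) < ∞
    rw [hsmul]
    exact ENNReal.mul_lt_top (by simp) hu.1
  · intro f hf hC
    have hcs : CauchySeq f := by
      refine EMetric.cauchySeq_iff.2 fun ε hε => ?_
      obtain ⟨N, hN⟩ := hC ε hε
      refine ⟨N, fun m hm n hn => ?_⟩
      rw [edist_eq_enorm_sub]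
      exact le_self_add.trans_lt (hN m hm n hn)
    obtain ⟨u, hu⟩ := cauchySeq_tendsto_of_complete hcs
    obtain ⟨ns, hns, hae⟩ := (tendstoInMeasure_of_tendsto_Lp hu).exists_seq_tendsto_ae
    -- With `n` fixed, lower semicontinuity is applied along `k` to `f n - f (ns k)`, whose energies
    -- the Cauchy condition bounds.
    have key : ∀ ε : ℝ≥0∞, 0 < ε → ∃ N, ∀ n ≥ N, E (f n - u) ^ (1 / 2 : ℝ) ≤ ε := by
      intro ε hε
      obtain ⟨N, hN⟩ := hC ε hε
      refine ⟨N, fun n hn => ?_⟩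
      rw [one_div, ENNReal.rpow_inv_le_iff two_pos, hE]
      have hlim : ∀ᵐ x ∂μ,
          Tendsto (fun k => (f n - f (ns k) : Lp ℝ 2 μ) x) atTop (𝓝 ((f n - u : Lp ℝ 2 μ) x)) := by
        filter_upwards [hae, Lp.coeFn_sub (f n) u,
          ae_all_iff.2 fun k => Lp.coeFn_sub (f n) (f (ns k))] with x h1 h2 h3
        simp only [h2, h3, Pi.sub_apply]
        exact tendsto_const_nhds.sub h1
      refine (energy_le_liminf hK (fun k => hmeas _) hlim).trans ?_
      refine liminf_le_of_frequently_le' (Eventually.frequently ?_)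
      filter_upwards [hns.tendsto_atTop.eventually_ge_atTop N] with k hk
      rw [← hE, ← ENNReal.rpow_inv_le_iff two_pos, ← one_div]
      exact le_add_self.trans (hN n hn (ns k) hk).le
    refine ⟨u, ⟨?_, hN.mem_of_tendsto hu (Eventually.of_forall fun n => (hf n).2)⟩, ?_⟩
    · obtain ⟨n, hn⟩ := key 1 one_pos
      have h1 := hn n le_rfl
      rw [one_div, ENNReal.rpow_inv_le_iff two_pos, ENNReal.one_rpow] at h1
      -- The limit has finite energy because `u = -(f n - u) + f n`.
      have h2 : E ((-1 : ℝ) • (f n - u)) < ∞ := by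
        rw [hsmul]
        exact ENNReal.mul_lt_top (by simp) (h1.trans_lt (by simp))
      have := haddfin h2 (hf n).1
      simpa [finiteEnergy] using this
    · have h1 : Tendsto (fun n => ‖f n - u‖ₑ) atTop (𝓝 0) := by
        simpa [edist_eq_enorm_sub] using tendsto_iff_edist_tendsto_0.1 hu
      have h2 : Tendsto (fun n => E (f n - u) ^ (1 / 2 : ℝ)) atTop (𝓝 0) :=
        ENNReal.tendsto_atTop_zero.2 key
      simpa [energyNorm] using h1.add h2

/-- The infimum of the measures of the cubes that contain both points, also on the diagonal. -/
noncomputable def cubeKernel (μ : Measure X) (D : ℤ → Set (Set X)) (x y : X) : ℝ≥0∞ :=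
  ⨅ j : ℤ, ⨅ Q ∈ D j,
    (Q ×ˢ Q).indicator (fun _ => μ Q) (x, y) + (Q ×ˢ Q)ᶜ.indicator (fun _ => ∞) (x, y)

/-- A cube missing one of the points contributes `∞` to `cubeKernel`, hence does not affect the
infimum. -/
theorem cubeKernel_eq_dyadicDist {x y : X} (hxy : x ≠ y) :
    dyadicDist μ D x y = cubeKernel μ D x y := by
  rw [dyadicDist, if_neg hxy, cubeKernel]
  refine le_antisymm (le_iInf fun j => le_iInf₂ fun Q hQ => ?_) (le_sInf ?_)
  · by_cases h : (x, y) ∈ Q ×ˢ Q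
    · rw [indicator_of_mem h, indicator_of_notMem (not_not_intro h), add_zero]
      exact sInf_le ⟨j, Q, hQ, h.1, h.2, rfl⟩
    · simp [indicator_of_mem (mem_compl h)]
  · rintro _ ⟨j, Q, hQ, hx, hy, rfl⟩
    refine (iInf_le _ j).trans ((iInf₂_le Q hQ).trans ?_)
    simp [hx, hy]

end Energy

/-! ### Cubes and balls in a regular space. -/

section Geometry

variable {X : Type*} [MetricSpace X] [MeasurableSpace X] {μ : Measure X} {γ : ℝ}
  {D : ℤ → Set (Set X)}

theorem IsAhlforsRegular.measure_ball_lt_top (hμ : IsAhlforsRegular μ γ) (x : X) (r : ℝ) :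
    μ (Metric.ball x r) < ∞ := by
  obtain ⟨c₁, c₂, -, -, h⟩ := hμ
  exact (measure_mono (Metric.ball_subset_ball (le_max_left r 1))).trans_lt
    ((h x (max r 1) (by positivity)).2.trans_lt ENNReal.ofReal_lt_top)

theorem IsAhlforsRegular.measure_ball_pos (hμ : IsAhlforsRegular μ γ) (x : X) {r : ℝ}
    (hr : 0 < r) : 0 < μ (Metric.ball x r) := by
  obtain ⟨c₁, c₂, hc₁, -, h⟩ := hμ
  exact (ENNReal.ofReal_pos.2 (by positivity)).trans_le (h x r hr).1

theorem IsAhlforsRegular.sigmaFinite (hμ : IsAhlforsRegular μ γ) : SigmaFinite μ := by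
  rcases isEmpty_or_nonempty X with hX | ⟨⟨x⟩⟩
  · rw [Measure.eq_zero_of_isEmpty μ]
    infer_instance
  · exact ⟨⟨{
      set := fun n => Metric.ball x n
      set_mem := fun _ => trivial
      finite := fun n => hμ.measure_ball_lt_top x n
      spanning := Metric.iUnion_ball_nat x }⟩⟩

/-- Every cube lies between two balls of comparable radii. -/
theorem IsDyadicFamily.exists_balls (hD : IsDyadicFamily D) :
    ∃ κ : ℝ, 0 < κ ∧ ∀ j, ∀ Q ∈ D j, ∃ (x₁ x₂ : X) (r₁ r₂ : ℝ), 0 < r₁ ∧ 0 < r₂ ∧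
      Metric.ball x₁ r₁ ⊆ Q ∧ Q ⊆ Metric.ball x₂ r₂ ∧ κ * r₂ ≤ r₁ := by
  obtain ⟨a, b, ha, -, h⟩ := hD.ecc
  -- The eccentricity is a supremum that need not be attained, hence half of its lower bound.
  refine ⟨a / 2, half_pos ha, fun j Q hQ => ?_⟩
  have h1 : ENNReal.ofReal (a / 2) < eccentricity Q :=
    ((ENNReal.ofReal_lt_ofReal_iff ha).2 (half_lt_self ha)).trans_le (h j Q hQ).1
  obtain ⟨_, ⟨x₁, x₂, r₁, r₂, h₁, h₂, hs₁, hs₂, rfl⟩, ht⟩ := lt_sSup_iff.1 h1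
  refine ⟨x₁, x₂, r₁, r₂, h₁, h₂, hs₁, hs₂, ?_⟩
  have := ((ENNReal.ofReal_lt_ofReal_iff (by positivity)).1 ht).le
  rwa [le_div_iff₀ h₂] at this

theorem IsDyadicFamily.measure_pos (hμ : IsAhlforsRegular μ γ) (hD : IsDyadicFamily D)
    {j : ℤ} {Q : Set X} (hQ : Q ∈ D j) : 0 < μ Q := by
  obtain ⟨κ, -, h⟩ := hD.exists_balls
  obtain ⟨x₁, -, r₁, -, h₁, -, hs, -⟩ := h j Q hQ
  exact (hμ.measure_ball_pos x₁ h₁).trans_le (measure_mono hs)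

theorem IsDyadicFamily.measure_lt_top (hμ : IsAhlforsRegular μ γ) (hD : IsDyadicFamily D)
    {j : ℤ} {Q : Set X} (hQ : Q ∈ D j) : μ Q < ∞ := by
  obtain ⟨κ, -, h⟩ := hD.exists_balls
  obtain ⟨-, x₂, -, r₂, -, -, -, hs, -⟩ := h j Q hQ
  exact (measure_mono hs).trans_lt (hμ.measure_ball_lt_top x₂ r₂)

/-- Disjoint sets of positive measure are countably many in a σ-finite space. -/
theorem IsDyadicFamily.countable (hμ : IsAhlforsRegular μ γ) (hD : IsDyadicFamily D) (j : ℤ) :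
    (D j).Countable := by
  have := hμ.sigmaFinite
  have h := Measure.countable_meas_pos_of_disjoint_iUnion (μ := μ)
    (As := fun Q : D j => (Q : Set X)) (fun Q => hD.measurable j Q Q.2)
    (fun P Q hPQ => (hD.partition j).pairwiseDisjoint P.2 Q.2 (Subtype.coe_ne_coe.2 hPQ))
  have h' : {Q : D j | 0 < μ (Q : Set X)} = univ :=
    eq_univ_of_forall fun Q => hD.measure_pos hμ Q.2
  rw [h'] at h
  exact countable_coe_iff.1 (countable_univ_iff.1 h)

theorem IsDyadicFamily.nonempty (hD : IsDyadicFamily D) {j : ℤ} {Q : Set X} (hQ : Q ∈ D j) :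
    Q.Nonempty :=
  nonempty_iff_ne_empty.2 fun h => (hD.partition j).1 (h ▸ hQ)

/-- One point from each cube of a fine enough level gives a countable `ε`-net. -/
theorem IsDyadicFamily.secondCountableTopology (hμ : IsAhlforsRegular μ γ)
    (hD : IsDyadicFamily D) : SecondCountableTopology X := by
  obtain ⟨ν, a, b, hν, hν1, -, hb, hdiam⟩ := hD.diam
  refine Metric.secondCountable_of_almost_dense_set fun ε hε => ?_
  obtain ⟨n, hn⟩ := exists_pow_lt_of_lt_one (div_pos hε hb) hν1
  have hc := hD.countable hμ (n : ℤ)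
  have hne : ∀ Q : D (n : ℤ), (Q : Set X).Nonempty := fun Q => hD.nonempty Q.2
  choose p hp using hne
  have : Countable (D (n : ℤ)) := hc.to_subtype
  refine ⟨range p, countable_range p, fun x => ?_⟩
  obtain ⟨Q, ⟨hQ, hx⟩, -⟩ := (hD.partition (n : ℤ)).2 x
  refine ⟨p ⟨Q, hQ⟩, mem_range_self _, ?_⟩
  have h1 := (Metric.edist_le_ediam_of_mem hx (hp ⟨Q, hQ⟩)).trans (hdiam _ Q hQ).2
  rw [edist_dist, ENNReal.ofReal_le_ofReal_iff (by positivity), zpow_natCast] at h1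
  refine h1.trans ?_
  rw [lt_div_iff₀ hb, mul_comm] at hn
  exact hn.le

/-- The balls are sections of an open subset of `(X × X) × X`; second countability makes this set
measurable for the product σ-algebra. -/
theorem measurable_measure_ball_dist [BorelSpace X] [SecondCountableTopology X] [SFinite μ] :
    Measurable (Function.uncurry fun x y => μ (Metric.ball x (dist x y))) := by
  have h : MeasurableSet {p : (X × X) × X | dist p.2 p.1.1 < dist p.1.1 p.1.2} :=
    (isOpen_lt (by fun_prop) (by fun_prop)).measurableSet
  exact measurable_measure_prodMk_left h

theorem measurable_cubeKernel (hμ : IsAhlforsRegular μ γ) (hD : IsDyadicFamily D) :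
    Measurable (Function.uncurry (cubeKernel μ D)) := by
  refine Measurable.iInf fun j => Measurable.biInf _ (hD.countable hμ j) fun Q hQ => ?_
  have hm := (hD.measurable j Q hQ).prod (hD.measurable j Q hQ)
  exact (measurable_const.indicator hm).add (measurable_const.indicator hm.compl)

/-- The kernel of the metric is dominated by the dyadic distance. -/
theorem exists_measure_ball_le_dyadicDist (hγ : 0 < γ) (hμ : IsAhlforsRegular μ γ)
    (hD : IsDyadicFamily D) : ∃ C : ℝ, 0 < C ∧ ∀ x y,
      μ (Metric.ball x (dist x y)) ≤ ENNReal.ofReal C * dyadicDist μ D x y := by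
  obtain ⟨κ, hκ, hb⟩ := hD.exists_balls
  obtain ⟨c₁, c₂, hc₁, hc₂, h⟩ := hμ
  -- From `d(x,y) < 2 r₂ ≤ (2 / κ) r₁` and `c₁ r₁ ^ γ ≤ μ(Q)`.
  refine ⟨c₂ * (2 / κ) ^ γ / c₁, by positivity, fun x y => ?_⟩
  rcases eq_or_ne x y with rfl | hxy
  · simp
  have hC : ENNReal.ofReal (c₂ * (2 / κ) ^ γ / c₁) ≠ 0 :=
    (ENNReal.ofReal_pos.2 (by positivity)).ne'
  rw [dyadicDist, if_neg hxy, ← ENNReal.div_le_iff' hC (by simp)]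
  refine le_sInf ?_
  rintro _ ⟨j, Q, hQ, hx, hy, rfl⟩
  rw [ENNReal.div_le_iff' hC (by simp)]
  obtain ⟨x₁, x₂, r₁, r₂, h₁, h₂, hs₁, hs₂, hr⟩ := hb j Q hQ
  have hd : dist x y ≤ 2 / κ * r₁ := by
    have h3 : dist x y < r₂ + r₂ :=
      (dist_triangle_right x y x₂).trans_lt (add_lt_add (hs₂ hx) (hs₂ hy))
    have h4 : r₂ ≤ r₁ / κ := by rwa [le_div_iff₀ hκ, mul_comm]
    calc dist x y ≤ 2 * (r₁ / κ) := by linarith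
      _ = 2 / κ * r₁ := by ring
  calc μ (Metric.ball x (dist x y)) ≤ ENNReal.ofReal (c₂ * dist x y ^ γ) :=
        (h x _ (dist_pos.2 hxy)).2
    _ ≤ ENNReal.ofReal (c₂ * (2 / κ) ^ γ / c₁ * (c₁ * r₁ ^ γ)) := by
        refine ENNReal.ofReal_le_ofReal ?_
        have h5 : dist x y ^ γ ≤ (2 / κ) ^ γ * r₁ ^ γ := by
          rw [← Real.mul_rpow (by positivity) h₁.le]
          exact Real.rpow_le_rpow dist_nonneg hd hγ.le
        calc c₂ * dist x y ^ γ ≤ c₂ * ((2 / κ) ^ γ * r₁ ^ γ) := by gcongr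
          _ = _ := by field_simp
    _ ≤ _ := by
        rw [ENNReal.ofReal_mul (by positivity)]
        gcongr
        exact (h x₁ r₁ h₁).1.trans (measure_mono hs₁)

/-- The measures of the cubes of a level are bounded away from zero. -/
theorem IsDyadicFamily.exists_le_measure (hγ : 0 < γ) (hμ : IsAhlforsRegular μ γ)
    (hD : IsDyadicFamily D) (j : ℤ) :
    ∃ m : ℝ, 0 < m ∧ ∀ Q ∈ D j, ENNReal.ofReal m ≤ μ Q := by
  obtain ⟨κ, hκ, hb⟩ := hD.exists_balls
  obtain ⟨ν, a, b, hν, -, ha, -, hdiam⟩ := hD.diam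
  obtain ⟨c₁, c₂, hc₁, -, h⟩ := hμ
  -- A lower bound for the inner radius: `a ν ^ j ≤ diam Q ≤ 2 r₂` and `κ r₂ ≤ r₁`.
  have hs : 0 < κ * (a * ν ^ j / 2) := by positivity
  refine ⟨c₁ * (κ * (a * ν ^ j / 2)) ^ γ, by positivity, fun Q hQ => ?_⟩
  obtain ⟨x₁, x₂, r₁, r₂, h₁, h₂, hs₁, hs₂, hr⟩ := hb j Q hQ
  refine le_trans ?_ ((h x₁ r₁ h₁).1.trans (measure_mono hs₁))
  refine ENNReal.ofReal_le_ofReal (mul_le_mul_of_nonneg_left ?_ hc₁.le)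
  refine Real.rpow_le_rpow hs.le (le_trans ?_ hr) hγ.le
  refine mul_le_mul_of_nonneg_left ?_ hκ.le
  have hd : Metric.ediam Q ≤ ENNReal.ofReal (2 * r₂) := by
    refine Metric.ediam_le fun x hx y hy => ?_
    rw [edist_dist]
    refine ENNReal.ofReal_le_ofReal ?_
    have := (dist_triangle_right x y x₂).trans (add_le_add (hs₂ hx).le (hs₂ hy).le)
    linarith
  have := (ENNReal.ofReal_le_ofReal_iff (by positivity)).1 ((hdiam j Q hQ).1.trans hd)
  linarith

/-- The kernel of the metric is bounded on the cubes of a level. -/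
theorem IsDyadicFamily.exists_measure_ball_le (hμ : IsAhlforsRegular μ γ)
    (hD : IsDyadicFamily D) (j : ℤ) : ∃ C : ℝ, 0 < C ∧ ∀ Q ∈ D j, ∀ x ∈ Q, ∀ y ∈ Q,
      μ (Metric.ball x (dist x y)) ≤ ENNReal.ofReal C := by
  obtain ⟨ν, a, b, hν, -, -, hb, hdiam⟩ := hD.diam
  obtain ⟨c₁, c₂, -, hc₂, h⟩ := hμ
  refine ⟨c₂ * (b * ν ^ j) ^ γ, by positivity, fun Q hQ x hx y hy => ?_⟩
  have h1 := (Metric.edist_le_ediam_of_mem hx hy).trans (hdiam j Q hQ).2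
  rw [edist_dist, ENNReal.ofReal_le_ofReal_iff (by positivity)] at h1
  -- The larger radius `b ν ^ j` is positive, so regularity applies even when `x = y`.
  exact (measure_mono (Metric.ball_subset_ball h1)).trans (h x _ (by positivity)).2

end Geometry

/-! ### Comparison of energies and coercivity on `Ker P_j`. -/

section Coercivity

variable {X : Type*} [MeasurableSpace X] {μ : Measure X} {σ : ℝ}

/-- A larger kernel has smaller energy. -/
theorem energy_le_of_le_mul (hσ : 0 < σ) {K K' : X → X → ℝ≥0∞} {C : ℝ} (hC : 0 < C)
    (h : ∀ x y, K x y ≤ ENNReal.ofReal C * K' x y) (u : X → ℝ) :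
    energy μ K' σ u ≤ ENNReal.ofReal C ^ (1 + 2 * σ) * energy μ K σ u := by
  have hp : 0 < 1 + 2 * σ := by positivity
  have hC0 : ENNReal.ofReal C ^ (1 + 2 * σ) ≠ 0 := by
    simp [ENNReal.rpow_eq_zero_iff, hC, hp.not_gt]
  have hCt : ENNReal.ofReal C ^ (1 + 2 * σ) ≠ ∞ := ENNReal.rpow_ne_top_of_nonneg hp.le (by simp)
  unfold energy
  rw [← lintegral_const_mul' _ _ hCt]
  refine lintegral_mono fun x => ?_
  dsimp only
  rw [← lintegral_const_mul' _ _ hCt]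
  refine lintegral_mono fun y => ?_
  have h1 : K x y ^ (1 + 2 * σ) ≤ ENNReal.ofReal C ^ (1 + 2 * σ) * K' x y ^ (1 + 2 * σ) := by
    rw [← ENNReal.mul_rpow_of_nonneg _ _ hp.le]
    exact ENNReal.rpow_le_rpow (h x y) hp.le
  calc ‖u x - u y‖ₑ ^ 2 / K' x y ^ (1 + 2 * σ)
      = ENNReal.ofReal C ^ (1 + 2 * σ) *
          (‖u x - u y‖ₑ ^ 2 / (ENNReal.ofReal C ^ (1 + 2 * σ) * K' x y ^ (1 + 2 * σ))) := by
        rw [div_eq_mul_inv, div_eq_mul_inv, ENNReal.mul_inv (Or.inl hC0) (Or.inl hCt),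
          mul_left_comm, ← mul_assoc (ENNReal.ofReal C ^ _), ENNReal.mul_inv_cancel hC0 hCt,
          one_mul]
    _ ≤ _ := by gcongr

/-- A function in `Ker P_j` has mean zero on every cube of level `j`. -/
theorem setIntegral_eq_zero_of_mem_levelKer {D : ℤ → Set (Set X)} {j : ℤ}
    (hpart : Setoid.IsPartition (D j)) {u : Lp ℝ 2 μ} (hu : u ∈ levelKer μ D j) {Q : Set X}
    (hQ : Q ∈ D j) (hmeas : ∀ P ∈ D j, MeasurableSet P) (hfin : μ Q ≠ ∞) :
    ∫ y in Q, u y ∂μ = 0 := by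
  have hmem : indicatorConstLp 2 (hmeas Q hQ) hfin (1 : ℝ) ∈ levelSpace μ D j := by
    intro P hP
    rcases eq_or_ne P Q with rfl | hPQ
    · refine ⟨1, ?_⟩
      filter_upwards [ae_restrict_of_ae (indicatorConstLp_coeFn (p := 2) (hs := hmeas P hP)
        (hμs := hfin) (c := (1 : ℝ))), ae_restrict_mem (hmeas P hP)] with x h1 h2
      rw [h1, indicator_of_mem h2]
    · refine ⟨0, ?_⟩
      filter_upwards [ae_restrict_of_ae (indicatorConstLp_coeFn (p := 2) (hs := hmeas Q hQ)
        (hμs := hfin) (c := (1 : ℝ))), ae_restrict_mem (hmeas P hP)] with x h1 h2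
      have hx : x ∉ Q := disjoint_left.1 (hpart.pairwiseDisjoint hP hQ hPQ) h2
      rw [h1, indicator_of_notMem hx]
  have hu' : (levelSpace μ D j).starProjection u = 0 := hu
  have h := Submodule.starProjection_inner_eq_zero (K := levelSpace μ D j) u _ hmem
  rw [hu', sub_zero, real_inner_comm, L2.inner_indicatorConstLp_one] at h
  exact h

/-- Expanding the square, the cross term integrates to zero and the term `u²` is dropped. -/
theorem measure_mul_enorm_sq_le_setLIntegral {Q : Set X} (hfin : μ Q ≠ ∞) {u : X → ℝ}
    (hu : MemLp u 2 μ) (h0 : ∫ y in Q, u y ∂μ = 0) (t : ℝ) :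
    μ Q * ‖t‖ₑ ^ 2 ≤ ∫⁻ y in Q, ‖t - u y‖ₑ ^ 2 ∂μ := by
  have : IsFiniteMeasure (μ.restrict Q) := ⟨by simpa using hfin.lt_top⟩
  have huQ : MemLp u 2 (μ.restrict Q) := hu.restrict Q
  have hi : Integrable u (μ.restrict Q) := huQ.integrable (by norm_num)
  have hsub : Integrable (fun y => (t - u y) ^ 2) (μ.restrict Q) :=
    ((memLp_const t).sub huQ).integrable_sq
  simp only [enorm_sq_eq_ofReal]
  rw [← ofReal_integral_eq_lintegral_ofReal hsub (ae_of_all _ fun y => sq_nonneg _),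
    ← ofReal_measureReal hfin, ← ENNReal.ofReal_mul measureReal_nonneg]
  refine ENNReal.ofReal_le_ofReal ?_
  calc μ.real Q * t ^ 2 = ∫ y in Q, (t ^ 2 - 2 * t * u y) ∂μ := by
        rw [integral_sub (integrable_const _) (hi.const_mul _), integral_const_mul, h0]
        simp
    _ ≤ _ := by
        refine integral_mono ((integrable_const _).sub (hi.const_mul _)) hsub fun y => ?_
        nlinarith [sq_nonneg (u y)]

theorem lintegral_enorm_sq_eq (u : Lp ℝ 2 μ) :
    ∫⁻ x, ‖u x‖ₑ ^ 2 ∂μ = ENNReal.ofReal (‖u‖ ^ 2) := by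
  rw [ENNReal.ofReal_pow (norm_nonneg _), ofReal_norm, Lp.enorm_def,
    eLpNorm_eq_lintegral_rpow_enorm_toReal (by norm_num) (by norm_num), ← ENNReal.rpow_natCast,
    ← ENNReal.rpow_mul]
  simp

/-- Coercivity of the energy on `Ker P_j` when the kernel is bounded on the cubes. -/
theorem le_energy_of_mem_levelKer (hσ : 0 < σ) {D : ℤ → Set (Set X)} {j : ℤ}
    (hpart : Setoid.IsPartition (D j)) (hmeas : ∀ Q ∈ D j, MeasurableSet Q)
    (hfin : ∀ Q ∈ D j, μ Q ≠ ∞) {K : X → X → ℝ≥0∞} {m C : ℝ≥0∞} (hC0 : C ≠ 0)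
    (hm : ∀ Q ∈ D j, m ≤ μ Q) (hC : ∀ Q ∈ D j, ∀ x ∈ Q, ∀ y ∈ Q, K x y ≤ C)
    {u : Lp ℝ 2 μ} (hu : u ∈ levelKer μ D j) :
    m / C ^ (1 + 2 * σ) * ENNReal.ofReal (‖u‖ ^ 2) ≤ energy μ K σ u := by
  have hp : 0 < 1 + 2 * σ := by positivity
  have hCp : (C ^ (1 + 2 * σ))⁻¹ ≠ ∞ := by
    simp [ENNReal.rpow_eq_zero_iff, hC0, hp.not_gt]
  rw [← lintegral_enorm_sq_eq]
  have hum : Measurable u := (Lp.stronglyMeasurable u).measurable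
  rw [← lintegral_const_mul _ (by fun_prop)]
  refine lintegral_mono fun x => ?_
  obtain ⟨Q, ⟨hQ, hx⟩, -⟩ := hpart.2 x
  calc m / C ^ (1 + 2 * σ) * ‖u x‖ₑ ^ 2 = (C ^ (1 + 2 * σ))⁻¹ * (m * ‖u x‖ₑ ^ 2) := by
        rw [div_eq_mul_inv]; ring
    _ ≤ (C ^ (1 + 2 * σ))⁻¹ * ∫⁻ y in Q, ‖u x - u y‖ₑ ^ 2 ∂μ := by
        gcongr
        refine le_trans ?_ (measure_mul_enorm_sq_le_setLIntegral (hfin Q hQ) (Lp.memLp u)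
          (setIntegral_eq_zero_of_mem_levelKer hpart hu hQ hmeas (hfin Q hQ)) (u x))
        gcongr
        exact hm Q hQ
    _ = ∫⁻ y in Q, (C ^ (1 + 2 * σ))⁻¹ * ‖u x - u y‖ₑ ^ 2 ∂μ :=
        (lintegral_const_mul' _ _ hCp).symm
    _ ≤ ∫⁻ y in Q, ‖u x - u y‖ₑ ^ 2 / K x y ^ (1 + 2 * σ) ∂μ := by
        refine setLIntegral_mono' (hmeas Q hQ) fun y hy => ?_
        rw [mul_comm, ← div_eq_mul_inv]
        gcongr
        exact hC Q hQ x hx y hy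
    _ ≤ _ := setLIntegral_le_lintegral _ _

end Coercivity

end DyadicCoercivity

theorem corollary3p4 {X : Type*} [MetricSpace X] [MeasurableSpace X] [BorelSpace X]
    (μ : Measure X) (γ : ℝ) (hγ : 0 < γ) (hμ : DyadicCoercivity.IsAhlforsRegular μ γ)
    (D : ℤ → Set (Set X)) (hD : DyadicCoercivity.IsDyadicFamily D)
    (σ : ℝ) (hσ : 0 < σ) (j : ℤ) :
    DyadicCoercivity.finiteEnergy (DyadicCoercivity.metricEnergy μ σ) ⊆
        DyadicCoercivity.finiteEnergy (DyadicCoercivity.dyadicEnergy μ D σ) ∧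
      DyadicCoercivity.IsHilbertSubspace (DyadicCoercivity.dyadicEnergy μ D σ)
        (DyadicCoercivity.finiteEnergy (DyadicCoercivity.dyadicEnergy μ D σ) ∩
          DyadicCoercivity.levelKer μ D j) ∧
      DyadicCoercivity.IsCoerciveOn (DyadicCoercivity.metricEnergy μ σ)
        (DyadicCoercivity.finiteEnergy (DyadicCoercivity.dyadicEnergy μ D σ) ∩
          DyadicCoercivity.levelKer μ D j) ∧
      DyadicCoercivity.IsCoercivitySpace (DyadicCoercivity.metricEnergy μ σ)
        (DyadicCoercivity.finiteEnergy (DyadicCoercivity.metricEnergy μ σ) ∩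
          DyadicCoercivity.levelKer μ D j) := by
  have := hμ.sigmaFinite
  have := hD.secondCountableTopology hμ
  have hclosed : IsClosed ((DyadicCoercivity.levelProj μ D j).ker : Set (Lp ℝ 2 μ)) :=
    (DyadicCoercivity.levelProj μ D j).isClosed_ker
  -- No finiteness of energy is needed, so one constant serves both coercivity claims.
  have hcoer : ∃ c : ℝ, 0 < c ∧ ∀ u ∈ DyadicCoercivity.levelKer μ D j,
      ENNReal.ofReal (c * ‖u‖ ^ 2) ≤ DyadicCoercivity.metricEnergy μ σ u := by
    obtain ⟨m, hm, hmQ⟩ := hD.exists_le_measure hγ hμ j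
    obtain ⟨C, hC, hCQ⟩ := hD.exists_measure_ball_le hμ j
    refine ⟨m / C ^ (1 + 2 * σ), by positivity, fun u hu => ?_⟩
    rw [ENNReal.ofReal_mul (by positivity), ENNReal.ofReal_div_of_pos (by positivity),
      ← ENNReal.ofReal_rpow_of_pos hC]
    exact DyadicCoercivity.le_energy_of_mem_levelKer hσ (hD.partition j) (hD.measurable j)
      (fun Q hQ => (hD.measure_lt_top hμ hQ).ne) (by simpa using hC) hmQ hCQ hu
  obtain ⟨c, hc, hcu⟩ := hcoer
  refine ⟨fun u hu => ?_, ?_, ⟨c, hc, fun u hu => hcu u hu.2⟩, ?_, c, hc, fun u hu => hcu u hu.2⟩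
  · obtain ⟨C, hC, hK⟩ := DyadicCoercivity.exists_measure_ball_le_dyadicDist hγ hμ hD
    exact (DyadicCoercivity.energy_le_of_le_mul hσ hC hK u).trans_lt
      (ENNReal.mul_lt_top (ENNReal.rpow_lt_top_of_nonneg (by positivity) (by simp)) hu)
  · exact DyadicCoercivity.isHilbertSubspace_inter
      (DyadicCoercivity.measurable_cubeKernel hμ hD) _ (fun u =>
        DyadicCoercivity.energy_congr_kernel
          (fun x y hxy => DyadicCoercivity.cubeKernel_eq_dyadicDist hxy) u) _ hclosed
  · exact DyadicCoercivity.isHilbertSubspace_inter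
      DyadicCoercivity.measurable_measure_ball_dist _ (fun u => rfl) _ hclosed
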